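/- Write $\mathbb{N}=\{1,2,3,\dots\}$. For $j,n\in\mathbb{N}$ let $c_j(n)$ be the number of ordered factorisations $n=m_1m_2\cdots m_j$ into $j$ integer factors, each at least $2$, and put $$c_j^{(0)}=c_j,\qquad c_j^{(r)}(n)=\sum_{m\mid n}c_j^{(r-1)}(m)\quad(r\in\mathbb{N}).$$ Let $\Omega(n)$ be the number of prime factors of $n$ counted with multiplicity (so $\Omega(1)=0$). Let $\mathbb{Z}_n=\mathbb{Z}/n\mathbb{Z}$. A matrix $M=(M_{i,j})_{i,j\in\mathbb{Z}_n}\in\mathbb{R}^{n\times n}$, with index arithmetic in $\mathbb{Z}_n$ and top left corner at $(1,1)$, is a *reversible square matrix* if for all $i,j,k,l\in\mathbb{Z}_n$ - $M_{i,j}+M_{i,n+1-j}=M_{i,k}+M_{i,n+1-k}$ and $M_{i,j}+M_{n+1-i,j}=M_{k,j}+M_{n+1-k,j}$, - $M_{i,j}+M_{k,l}=M_{i,l}+M_{k,j}$. It is a *principal reversible square* if moreover $\{M_{i,j}\mid i,j\in\mathbb{Z}_n\}=\{1,2,\dots,n^2\}$, the entries in each row and each column, read in the order of the indices $1,2,\dots,n$,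 are increasing, and $M_{1,j}=j$ for $j\in\{1,2\}$ (for $n=1$ the last condition cannot hold, because $1=2$ in $\mathbb{Z}_1$, so there is no $1\times1$ principal reversible square). **Theorem.** Let $n\in\mathbb{N}$. The number $N_n$ of different $n\times n$ principal reversible squares is finite and is given by $$N_n=\sum_{j=1}^{\Omega(n)}c_j(n)\bigl(c_j(n)+c_{j+1}(n)\bigr)=\sum_{j=1}^{\Omega(n)}c_j^{(0)}(n)\,c_j^{(1)}(n).$$ -/

import Mathlib

/-- The `j`-th non-trivial divisor function `c_j`: `nontrivDivisor j n` is the number of ordered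
factorisations `n = m_1 ⋯ m_j` into `j` factors, each of which is at least `2`. -/
def nontrivDivisor (j n : ℕ) : ℕ :=
  ((Nat.finMulAntidiag j n).filter (fun m : Fin j → ℕ => ∀ k, 2 ≤ m k)).card

/-- The associated divisor functions: `assocDivisor r j` is `c_j^{(r)}`, with `c_j^{(0)} = c_j` and
`c_j^{(r)}(n) = ∑_{m ∣ n} c_j^{(r-1)}(m)`. -/
def assocDivisor : ℕ → ℕ → ℕ → ℕ
  | 0, j, n => nontrivDivisor j n
  | r + 1, j, n => ∑ m ∈ n.divisors, assocDivisor r j m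

/-- Reversible square matrices. The indices lie in the cyclic ring `ZMod n`; the top left corner
has indices `(1, 1)`. -/
structure IsReversibleSquare (n : ℕ) (M : Matrix (ZMod n) (ZMod n) ℝ) : Prop where
  /-- row reversal symmetry -/
  row_reversal : ∀ i j k : ZMod n,
    M i j + M i ((n : ZMod n) + 1 - j) = M i k + M i ((n : ZMod n) + 1 - k)
  /-- column reversal symmetry -/
  col_reversal : ∀ i j k : ZMod n,
    M i j + M ((n : ZMod n) + 1 - i) j = M k j + M ((n : ZMod n) + 1 - k) j
  /-- vertex cross sum property -/
  vertex : ∀ i j k l : ZMod n, M i j + M k l = M i l + M k j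

/-- Principal reversible squares. Rows and columns are read in the order of the representatives
`1, 2, …, n` of the residue classes. -/
structure IsPrincipalReversibleSquare (n : ℕ) (M : Matrix (ZMod n) (ZMod n) ℝ) : Prop
    extends IsReversibleSquare n M where
  /-- the set of entries is `{1, 2, …, n ^ 2}` -/
  entries : {x : ℝ | ∃ i j : ZMod n, M i j = x} = {x : ℝ | ∃ m : ℕ, 1 ≤ m ∧ m ≤ n ^ 2 ∧ x = m}
  /-- the entries of each row increase -/
  row_increasing : ∀ (i : ZMod n) (a b : ℕ), 1 ≤ a → a < b → b ≤ n →
    M i (a : ZMod n) < M i (b : ZMod n)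
  /-- the entries of each column increase -/
  col_increasing : ∀ (j : ZMod n) (a b : ℕ), 1 ≤ a → a < b → b ≤ n →
    M (a : ZMod n) j < M (b : ZMod n) j
  /-- `M_{1,j} = j` for `j ∈ {1, 2}` -/
  first_entries : ∀ j : ℕ, j = 1 ∨ j = 2 → M 1 (j : ZMod n) = j

/-- The number `N_n` of `n × n` principal reversible squares, counted in `ℕ∞`. -/
noncomputable def numPrincipalReversibleSquares (n : ℕ) : ℕ∞ :=
  Set.encard {M : Matrix (ZMod n) (ZMod n) ℝ | IsPrincipalReversibleSquare n M}

/-! The vertex condition forces `M i j = 1 + a i + b j`. With `A`, `B` the value sets of `a`, `b`,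
the entry condition says that every `x < n ^ 2` is uniquely `a + b` (`IsTiling A B (n * n)`), and `M
1 2 = 2` says `1 ∈ B`. Conversely every such tiling gives a square, because its two sets are
automatically centrally symmetric. So the squares biject with `tilingsOne n n`.

Tilings obey a de Bruijn type descent: if `1 ∈ B` and `k` is the least number outside `B`, then `A =
k A'` and `B = k B' + [0, k)` for a tiling `(A', B')` with `1 ∉ B'` (`IsTiling.block`,
`IsTiling.exists_dilate_inflate`). Unless `(A', B')` is trivial, `1 ∈ A'` and the roles swap. With
`T a b` the number of tilings of cardinalities `a`, `b` and `1 ∈ B`, this gives `T a b = ∑ ([a = b /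
k = 1] + T (b / k) a)` over divisors `k ≥ 2` of `b`. Splitting off one factor of an ordered
factorisation yields the same recursion for `∑ c_{j+1}(b) (c_j(a) + c_{j+1}(a))`. -/

/-! ### Ordered factorisations -/

theorem mem_factorisations {j n : ℕ} {f : Fin j → ℕ} :
    f ∈ (Nat.finMulAntidiag j n).filter (fun m : Fin j → ℕ => ∀ k, 2 ≤ m k) ↔
      (∏ i, f i = n ∧ n ≠ 0) ∧ ∀ k, 2 ≤ f k := by
  rw [Finset.mem_filter, Nat.mem_finMulAntidiag]

theorem nontrivDivisor_zero_left (n : ℕ) : nontrivDivisor 0 n = if n = 1 then 1 else 0 := by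
  unfold nontrivDivisor
  split_ifs with h
  · subst h
    rw [Nat.finMulAntidiag_one]
    simp
  · rw [Nat.finMulAntidiag_zero_left h]
    simp

/-- Split off the first factor `k`. -/
theorem nontrivDivisor_succ (j n : ℕ) :
    nontrivDivisor (j + 1) n = ∑ k ∈ n.divisors with 2 ≤ k, nontrivDivisor j (n / k) := by
  unfold nontrivDivisor
  rw [← Finset.card_sigma]
  refine Finset.card_nbij' (fun f => ⟨f 0, Fin.tail f⟩) (fun p => Fin.cons p.1 p.2) ?_ ?_ ?_ ?_
  · intro f hf
    obtain ⟨⟨h1, h2⟩, h3⟩ := mem_factorisations.1 hf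
    rw [Fin.prod_univ_succ] at h1
    have h0 : 0 < f 0 := by have := h3 0; omega
    have hdiv : n / f 0 = ∏ i : Fin j, f i.succ := by
      rw [← h1, Nat.mul_div_cancel_left _ h0]
    refine Finset.mem_coe.2 (Finset.mem_sigma.2 ⟨?_, mem_factorisations.2 ⟨⟨?_, ?_⟩, ?_⟩⟩)
    · exact Finset.mem_filter.2 ⟨Nat.mem_divisors.2 ⟨⟨_, h1.symm⟩, h2⟩, h3 0⟩
    · exact hdiv.symm
    · intro h
      apply h2
      rw [← h1, ← hdiv]
      simp only at h
      rw [h, mul_zero]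
    · intro k
      exact h3 k.succ
  · rintro ⟨k, f⟩ hf
    obtain ⟨h1, h2⟩ := Finset.mem_sigma.1 (Finset.mem_coe.1 hf)
    obtain ⟨⟨h3, h4⟩, h5⟩ := mem_factorisations.1 h2
    obtain ⟨h6, h7⟩ := Finset.mem_filter.1 h1
    simp only at h3 h4 h5 h6 h7
    refine Finset.mem_coe.2 (mem_factorisations.2 ⟨⟨?_, (Nat.mem_divisors.1 h6).2⟩, ?_⟩)
    · rw [Fin.prod_univ_succ]
      simp only [Fin.cons_zero, Fin.cons_succ]
      rw [h3, Nat.mul_div_cancel' (Nat.mem_divisors.1 h6).1]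
    · intro i
      refine Fin.cases ?_ (fun i => ?_) i
      · exact h7
      · exact h5 i
  · intro f _
    exact Fin.cons_self_tail f
  · rintro ⟨k, f⟩ _
    simp

theorem nontrivDivisor_eq_zero {j n : ℕ} (h : ArithmeticFunction.cardFactors n < j) :
    nontrivDivisor j n = 0 := by
  induction j generalizing n with
  | zero => omega
  | succ j ih =>
    rw [nontrivDivisor_succ]
    refine Finset.sum_eq_zero fun k hk => ih ?_
    obtain ⟨h1, h2⟩ := Finset.mem_filter.1 hk
    obtain ⟨⟨m, rfl⟩, h3⟩ := Nat.mem_divisors.1 h1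
    have hm : m ≠ 0 := right_ne_zero_of_mul h3
    rw [Nat.mul_div_cancel_left _ (by omega)]
    rw [ArithmeticFunction.cardFactors_mul (by omega) hm] at h
    have : ArithmeticFunction.cardFactors k ≠ 0 := by
      rw [Ne, ArithmeticFunction.cardFactors_eq_zero_iff_eq_zero_or_one]
      omega
    omega

/-- A crude bound, allowing sums over `j` to run over any sufficiently long range. -/
theorem cardFactors_lt_self {n : ℕ} (hn : n ≠ 0) : ArithmeticFunction.cardFactors n < n := by
  induction n using Nat.recOnMul with
  | zero => exact absurd rfl hn
  | one => simp
  | prime p hp =>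
    rw [ArithmeticFunction.cardFactors_apply_prime hp]
    exact hp.one_lt
  | mul a b iha ihb =>
    have ha := left_ne_zero_of_mul hn
    have hb := right_ne_zero_of_mul hn
    rw [ArithmeticFunction.cardFactors_mul ha hb]
    have h1 := iha ha
    have h2 := ihb hb
    nlinarith

/-- Replace `m` by `n / k`: the term `k = 1` is `c_j(n)`, and the terms `k ≥ 2` sum to `c_{j+1}(n)`.
-/
theorem sum_divisors_nontrivDivisor (j : ℕ) {n : ℕ} (hn : n ≠ 0) :
    ∑ m ∈ n.divisors, nontrivDivisor j m = nontrivDivisor j n + nontrivDivisor (j + 1) n := by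
  rw [nontrivDivisor_succ, ← Nat.sum_div_divisors,
    ← Finset.sum_filter_add_sum_filter_not n.divisors (fun k => 2 ≤ k), add_comm]
  congr 1
  have : n.divisors.filter (fun k => ¬ 2 ≤ k) = {1} := by
    ext k
    simp only [Finset.mem_filter, Nat.mem_divisors, Finset.mem_singleton]
    constructor
    · rintro ⟨⟨h1, _⟩, h2⟩
      have := Nat.pos_of_dvd_of_pos h1 (Nat.pos_of_ne_zero hn)
      omega
    · rintro rfl
      exact ⟨⟨one_dvd _, hn⟩, by omega⟩
  rw [this]
  simp

/-! ### Tilings of an initial interval by two sets -/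

/-- Every natural number below `N` is uniquely a sum of an element of `A` and one of `B`, and
there are no other such sums. -/
structure IsTiling (A B : Finset ℕ) (N : ℕ) : Prop where
  lt : ∀ {a b}, a ∈ A → b ∈ B → a + b < N
  exists_add : ∀ x < N, ∃ a ∈ A, ∃ b ∈ B, a + b = x
  left_unique : ∀ {a b a' b'}, a ∈ A → b ∈ B → a' ∈ A → b' ∈ B → a + b = a' + b' → a = a'

namespace IsTiling

variable {A B : Finset ℕ} {N k : ℕ}

theorem symm (h : IsTiling A B N) : IsTiling B A N where
  lt hb ha := by rw [add_comm]; exact h.lt ha hb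
  exists_add x hx := by
    obtain ⟨a, ha, b, hb, e⟩ := h.exists_add x hx
    exact ⟨b, hb, a, ha, by omega⟩
  left_unique hb ha hb' ha' e := by
    have := h.left_unique ha hb ha' hb' (by omega)
    omega

theorem zero_mem_left (h : IsTiling A B N) (hN : 0 < N) : 0 ∈ A := by
  obtain ⟨a, ha, b, hb, e⟩ := h.exists_add 0 hN
  obtain rfl : a = 0 := by omega
  exact ha

theorem zero_mem_right (h : IsTiling A B N) (hN : 0 < N) : 0 ∈ B := h.symm.zero_mem_left hN

theorem card_mul_card (h : IsTiling A B N) : A.card * B.card = N := by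
  have : (A ×ˢ B).image (fun p => p.1 + p.2) = Finset.range N := by
    ext x
    simp only [Finset.mem_image, Finset.mem_product, Prod.exists, Finset.mem_range]
    constructor
    · rintro ⟨a, b, ⟨ha, hb⟩, rfl⟩
      exact h.lt ha hb
    · intro hx
      obtain ⟨a, ha, b, hb, e⟩ := h.exists_add x hx
      exact ⟨a, b, ⟨ha, hb⟩, e⟩
  rw [← Finset.card_range N, ← this, Finset.card_image_of_injOn, Finset.card_product]
  rintro ⟨a, b⟩ hab ⟨a', b'⟩ hab' e
  simp only [Finset.coe_product, Set.mem_prod, Finset.mem_coe] at hab hab' e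
  have := h.left_unique hab.1 hab.2 hab'.1 hab'.2 e
  ext
  · exact this
  · simp only; omega

/-- A surjection between finite sets of equal size is injective. -/
theorem of_card (hlt : ∀ {a b}, a ∈ A → b ∈ B → a + b < N)
    (hex : ∀ x < N, ∃ a ∈ A, ∃ b ∈ B, a + b = x) (hc : A.card * B.card = N) :
    IsTiling A B N where
  lt := hlt
  exists_add := hex
  left_unique := by
    have him : (A ×ˢ B).image (fun p => p.1 + p.2) = Finset.range N := by
      ext x
      simp only [Finset.mem_image, Finset.mem_product, Prod.exists, Finset.mem_range]
      constructor
      · rintro ⟨a, b, ⟨ha, hb⟩, rfl⟩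
        exact hlt ha hb
      · intro hx
        obtain ⟨a, ha, b, hb, e⟩ := hex x hx
        exact ⟨a, b, ⟨ha, hb⟩, e⟩
    have hinj : Set.InjOn (fun p : ℕ × ℕ => p.1 + p.2) (A ×ˢ B : Finset (ℕ × ℕ)) := by
      rw [← Finset.card_image_iff, him, Finset.card_range, Finset.card_product, hc]
    intro a b a' b' ha hb ha' hb' e
    have := @hinj (a, b) (by simp [ha, hb]) (a', b') (by simp [ha', hb']) e
    exact congrArg Prod.fst this

theorem left_subset_range (h : IsTiling A B N) (hN : 0 < N) : A ⊆ Finset.range N := fun _ ha =>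
  Finset.mem_range.2 (h.lt ha (h.zero_mem_right hN))

theorem not_one_mem_both (h : IsTiling A B N) (hN : 0 < N) (hA : 1 ∈ A) (hB : 1 ∈ B) : False := by
  have := h.left_unique hA (h.zero_mem_right hN) (h.zero_mem_left hN) hB rfl
  omega

theorem one_mem_or (h : IsTiling A B N) (hN : 1 < N) : 1 ∈ A ∨ 1 ∈ B := by
  obtain ⟨a, ha, b, hb, e⟩ := h.exists_add 1 hN
  obtain ⟨rfl, rfl⟩ | ⟨rfl, rfl⟩ : (a = 0 ∧ b = 1) ∨ (a = 1 ∧ b = 0) := by omega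
  · exact Or.inr hb
  · exact Or.inl ha

/-- If `[0, k)` is the initial run of `B`, then every block `[mk, mk + k)` meets `A` at most in its
first element, and is contained in `B` or disjoint from it. -/
theorem block (h : IsTiling A B N) (hN : 0 < N) (hk2 : 2 ≤ k) (hk : ∀ i < k, i ∈ B) (hkB : k ∉ B)
    (m : ℕ) : (∀ i, 0 < i → i < k → m * k + i ∉ A) ∧ ∀ i < k, (m * k + i ∈ B ↔ m * k ∈ B) := by
  have hA0 := h.zero_mem_left hN
  have hB0 := h.zero_mem_right hN
  have hAi : ∀ i, 0 < i → i < k → i ∉ A := fun i h0 hik hi => by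
    have := h.left_unique hi hB0 hA0 (hk i hik) (by omega)
    omega
  induction m using Nat.strong_induction_on with
  | _ m ih =>
  rcases Nat.eq_zero_or_pos m with rfl | hm
  · simp only [zero_mul, zero_add]
    exact ⟨hAi, fun i hi => ⟨fun _ => hB0, fun _ => hk i hi⟩⟩
  have ihA : ∀ a ∈ A, a < m * k → ∃ q < m, a = q * k := fun a ha hlt => by
    have hq : a / k < m := (Nat.div_lt_iff_lt_mul (by omega)).2 hlt
    refine ⟨a / k, hq, ?_⟩
    by_contra hne
    have e := Nat.div_add_mod' a k
    refine (ih _ hq).1 (a % k) (by omega) (Nat.mod_lt _ (by omega)) ?_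
    rwa [e]
  have hkx : k ≤ m * k := Nat.le_mul_of_pos_left k hm
  rcases le_or_gt N (m * k) with hNx | hxN
  · refine ⟨fun i _ _ hi => ?_, fun i _ => ⟨fun hi => ?_, fun hi => ?_⟩⟩
    · have := h.lt hi hB0; omega
    · have := h.lt hA0 hi; omega
    · have := h.lt hA0 hi; omega
  -- Since `k ∉ B` and `A` has no element strictly between `0` and `k`, only `k = k + 0` is
  -- possible.
  have hkA : k ∈ A := by
    obtain ⟨a, ha, b, hb, e⟩ := h.exists_add k (by omega)
    by_cases h0 : a = 0
    · obtain rfl : b = k := by omega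
      exact absurd hb hkB
    by_cases h1 : a = k
    · exact h1 ▸ ha
    exact absurd ha (hAi a (by omega) (by omega))
  -- The decomposition `m * k = a + b` governs the whole block: the cases are `b = 0`, `a = 0`, and
  -- both positive.
  obtain ⟨a, ha, b, hb, e⟩ := h.exists_add _ hxN
  by_cases hb0 : b = 0
  · obtain rfl : a = m * k := by omega
    have hB : ∀ i < k, m * k + i ∉ B := fun i hi hi' => by
      have := h.left_unique hA0 hi' ha (hk i hi) (by omega)
      omega
    refine ⟨fun i h0 hik hi => ?_, fun i hi => iff_of_false (hB i hi) (hB 0 (by omega))⟩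
    have := h.left_unique hi hB0 ha (hk i hik) (by omega)
    omega
  by_cases ha0 : a = 0
  · obtain rfl : b = m * k := by omega
    -- Since `k + m * k < N`, the whole block lies below `N` and each of its elements decomposes.
    have hlt := h.lt hkA hb
    have hB : ∀ i < k, m * k + i ∈ B := by
      intro i hi
      obtain ⟨c, hc, d, hd, e'⟩ := h.exists_add (m * k + i) (by omega)
      rcases le_or_gt (m * k) c with hxc | hcx
      · rcases Nat.eq_or_lt_of_le hxc with rfl | hxc
        · have := h.left_unique hc hB0 hA0 hb (by omega)
          omega
        -- Here `m * k < c < m * k + k`, so `c + (m * k + k - c) = k + m * k` gives two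
        -- decompositions.
        · have := h.left_unique hc (hk (m * k + k - c) (by omega)) hkA hb (by omega)
          omega
      rcases le_or_gt (m * k) d with hxd | hdx
      · by_cases hc0 : c = 0
        · obtain rfl : d = m * k + i := by omega
          exact hd
        · exact absurd hc (hAi c (by omega) (by omega))
      exfalso
      -- Both summands are below `m * k`; shifting `d` back by `i` inside its block decomposes `m *
      -- k` a second time, besides `0 + m * k`.
      obtain ⟨q, hq, rfl⟩ := ihA c hc hcx
      obtain ⟨r, rfl⟩ := Nat.exists_eq_add_of_lt hq
      have hq0 : 0 < q := by
        rcases Nat.eq_zero_or_pos q with rfl | hq0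
        · simp only [zero_mul, zero_add] at *; omega
        · exact hq0
      have e2 : (q + r + 1) * k = q * k + (r + 1) * k := by ring
      obtain rfl : d = (r + 1) * k + i := by omega
      have hr := ((ih (r + 1) (by omega)).2 i hi).1 hd
      have := h.left_unique hc hr hA0 hb (by omega)
      have : 0 < q * k := Nat.mul_pos hq0 (by omega)
      omega
    refine ⟨fun i h0 hik hi => ?_, fun i hi => iff_of_true (hB i hi) hb⟩
    have := h.left_unique hi hB0 hA0 (hB i hik) (by omega)
    omega
  -- Both `a` and `b` are positive multiples of `k`, and the block at `b` lies in `B`, so `a + (b +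
  -- i)` already represents `m * k + i`.
  obtain ⟨q, hq, rfl⟩ := ihA a ha (by omega)
  obtain ⟨r, rfl⟩ := Nat.exists_eq_add_of_lt hq
  have hq0 : 0 < q := Nat.pos_of_ne_zero fun h0 => ha0 (by rw [h0, zero_mul])
  have e2 : (q + r + 1) * k = q * k + (r + 1) * k := by ring
  obtain rfl : b = (r + 1) * k := by omega
  have hr : ∀ i < k, (r + 1) * k + i ∈ B := fun i hi => ((ih (r + 1) (by omega)).2 i hi).2 hb
  have hB : ∀ i < k, (q + r + 1) * k + i ∉ B := fun i hi hi' => by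
    have := h.left_unique hA0 hi' ha (hr i hi) (by omega)
    omega
  refine ⟨fun i h0 hik hi => ?_, fun i hi => iff_of_false (hB i hi) (hB 0 (by omega))⟩
  have := h.left_unique hi hB0 ha (hr i hik) (by omega)
  omega

end IsTiling

/-! ### Scaling a tiling up by a factor -/

/-- The multiples `k * a` of the elements of `A`. -/
def dilate (k : ℕ) (A : Finset ℕ) : Finset ℕ := A.image (k * ·)

/-- The union of the blocks `[k * b, k * b + k)` over `b ∈ B`. -/
def inflate (k : ℕ) (B : Finset ℕ) : Finset ℕ :=
  (B ×ˢ Finset.range k).image fun p => k * p.1 + p.2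

section

variable {A B : Finset ℕ} {N k : ℕ}

theorem mul_mem_dilate (hk : 0 < k) {m : ℕ} : k * m ∈ dilate k A ↔ m ∈ A := by
  simp [dilate, hk.ne']

theorem mem_dilate {x : ℕ} : x ∈ dilate k A ↔ ∃ a ∈ A, k * a = x := by
  simp [dilate]

theorem mem_inflate (hk : 0 < k) {x : ℕ} : x ∈ inflate k B ↔ x / k ∈ B := by
  simp only [inflate, Finset.mem_image, Finset.mem_product, Finset.mem_range, Prod.exists]
  constructor
  · rintro ⟨b, i, ⟨hb, hi⟩, rfl⟩
    rwa [Nat.mul_add_div hk, Nat.div_eq_of_lt hi, add_zero]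
  · intro hx
    exact ⟨x / k, x % k, ⟨hx, Nat.mod_lt _ hk⟩, Nat.div_add_mod x k⟩

theorem dilate_injective (hk : 0 < k) : Function.Injective (dilate k) := fun A B h => by
  ext m
  rw [← mul_mem_dilate hk, h, mul_mem_dilate hk]

theorem inflate_injective (hk : 0 < k) : Function.Injective (inflate k) := fun A B h => by
  ext m
  have := mem_inflate hk (B := A) (x := k * m)
  rw [h, mem_inflate hk, Nat.mul_div_cancel_left _ hk] at this
  exact this.symm

theorem card_dilate (hk : 0 < k) : (dilate k A).card = A.card :=
  Finset.card_image_of_injective _ fun _ _ h => Nat.eq_of_mul_eq_mul_left hk h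

theorem card_inflate : (inflate k B).card = k * B.card := by
  rw [inflate, Finset.card_image_of_injOn, Finset.card_product, Finset.card_range, mul_comm]
  rintro ⟨b, i⟩ h ⟨b', i'⟩ h' e
  simp only [Finset.coe_product, Set.mem_prod, Finset.mem_coe, Finset.mem_range] at h h' e
  have hk : 0 < k := by omega
  have e1 := congrArg (· / k) e
  simp only [Nat.mul_add_div hk, Nat.div_eq_of_lt h.2, Nat.div_eq_of_lt h'.2, add_zero] at e1
  subst e1
  simp only [add_right_inj] at e
  rw [e]

/-- Division by `k` carries one tiling to the other, as `(k * a + x) / k = a + x / k`; the remainder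
sits entirely in the inflated set. -/
theorem isTiling_dilate_inflate (hk : 0 < k) :
    IsTiling (dilate k A) (inflate k B) (k * N) ↔ IsTiling A B N := by
  have hdiv : ∀ a b, (k * a + b) / k = a + b / k := fun a b => Nat.mul_add_div hk a b
  constructor
  · intro h
    have hb' : ∀ {b}, b ∈ B → k * b ∈ inflate k B := fun hb => by
      rwa [mem_inflate hk, Nat.mul_div_cancel_left _ hk]
    refine ⟨fun ha hb => ?_, fun x hx => ?_, fun ha hb ha' hb' e => ?_⟩
    · have := h.lt ((mul_mem_dilate hk).2 ha) (hb' hb)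
      rw [← mul_add] at this
      exact lt_of_mul_lt_mul_left this (Nat.zero_le _)
    · obtain ⟨a, ha, b, hb, e⟩ := h.exists_add (k * x) (Nat.mul_lt_mul_of_pos_left hx hk)
      obtain ⟨c, hc, rfl⟩ := mem_dilate.1 ha
      refine ⟨c, hc, b / k, (mem_inflate hk).1 hb, ?_⟩
      rw [← hdiv, e, Nat.mul_div_cancel_left _ hk]
    · rename_i hbb _ _ _ _
      have := h.left_unique ((mul_mem_dilate hk).2 ha) (hbb hb) ((mul_mem_dilate hk).2 ha')
        (hbb hb') (by rw [← mul_add, ← mul_add, e])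
      exact Nat.eq_of_mul_eq_mul_left hk this
  · intro h
    refine ⟨fun ha hb => ?_, fun x hx => ?_, fun ha hb ha' hb' e => ?_⟩
    · obtain ⟨c, hc, rfl⟩ := mem_dilate.1 ha
      rw [mul_comm k N, ← Nat.div_lt_iff_lt_mul hk, hdiv]
      exact h.lt hc ((mem_inflate hk).1 hb)
    · obtain ⟨a, ha, b, hb, e⟩ := h.exists_add (x / k)
        ((Nat.div_lt_iff_lt_mul hk).2 (by rwa [mul_comm]))
      refine ⟨k * a, (mul_mem_dilate hk).2 ha, k * b + x % k, ?_, ?_⟩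
      · rwa [mem_inflate hk, hdiv, Nat.div_eq_of_lt (Nat.mod_lt _ hk), add_zero]
      · rw [← add_assoc, ← mul_add, e, Nat.div_add_mod]
    · obtain ⟨c, hc, rfl⟩ := mem_dilate.1 ha
      obtain ⟨c', hc', rfl⟩ := mem_dilate.1 ha'
      have e1 := congrArg (· / k) e
      simp only [hdiv] at e1
      rw [h.left_unique hc ((mem_inflate hk).1 hb) hc' ((mem_inflate hk).1 hb') e1]

/-- A tiling whose second member contains `1` arises from a smaller one whose second member
does not. -/
theorem IsTiling.exists_dilate_inflate (h : IsTiling A B N) (hN : 0 < N) (h1 : 1 ∈ B) :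
    ∃ k A' B' N', 2 ≤ k ∧ A = dilate k A' ∧ B = inflate k B' ∧ N = k * N' ∧
      IsTiling A' B' N' ∧ 1 ∉ B' := by
  classical
  have hex : ∃ k, k ∉ B := Infinite.exists_notMem_finset B
  obtain ⟨k, hkB, hk⟩ : ∃ k, k ∉ B ∧ ∀ i < k, i ∈ B :=
    ⟨Nat.find hex, Nat.find_spec hex, fun i hi => not_not.1 (Nat.find_min hex hi)⟩
  have h0 := h.zero_mem_right hN
  have hk2 : 2 ≤ k := by
    by_contra hlt
    obtain rfl | rfl : k = 0 ∨ k = 1 := by omega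
    · exact hkB h0
    · exact hkB h1
  have hk0 : 0 < k := by omega
  have hbl := h.block hN hk2 hk hkB
  have hA : A = dilate k (A.image (· / k)) := by
    have hdvd : ∀ a ∈ A, k * (a / k) = a := fun a ha => by
      have e := Nat.div_add_mod' a k
      by_contra hne
      rw [mul_comm] at hne
      refine (hbl (a / k)).1 (a % k) (by omega) (Nat.mod_lt _ hk0) ?_
      rwa [e]
    ext x
    simp only [mem_dilate, Finset.mem_image, exists_exists_and_eq_and]
    constructor
    · exact fun hx => ⟨x, hx, hdvd x hx⟩
    · rintro ⟨a, ha, rfl⟩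
      rwa [hdvd a ha]
  have hB : B = inflate k ((B.image (· / k))) := by
    ext x
    rw [mem_inflate hk0]
    constructor
    · exact fun hx => Finset.mem_image_of_mem _ hx
    · intro hx
      obtain ⟨b, hb, e⟩ := Finset.mem_image.1 hx
      have e1 := Nat.div_add_mod' b k
      have e2 := Nat.div_add_mod' x k
      rw [e] at e1
      rw [← e1, (hbl _).2 _ (Nat.mod_lt _ hk0)] at hb
      rwa [← e2, (hbl _).2 _ (Nat.mod_lt _ hk0)]
  have hN' : N = k * (A.card * (B.image (· / k)).card) := by
    conv_lhs => rw [← h.card_mul_card, hB, card_inflate]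
    ring
  refine ⟨k, _, _, _, hk2, hA, hB, hN', ?_, fun hk1 => hkB ?_⟩
  · rw [← isTiling_dilate_inflate hk0, ← hA, ← hB, ← hN']
    exact h
  · rw [hB, mem_inflate hk0, Nat.div_self hk0]
    exact hk1

end

/-! ### Central symmetry of tilings -/

/-- `A` is symmetric about some point. -/
def IsCentrallySymmetric (A : Finset ℕ) : Prop := ∃ s, ∀ a ∈ A, ∃ a' ∈ A, a + a' = s

theorem IsCentrallySymmetric.dilate {A : Finset ℕ} (h : IsCentrallySymmetric A) (k : ℕ) :
    IsCentrallySymmetric (dilate k A) := by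
  obtain ⟨s, hs⟩ := h
  refine ⟨k * s, fun x hx => ?_⟩
  obtain ⟨a, ha, rfl⟩ := mem_dilate.1 hx
  obtain ⟨a', ha', rfl⟩ := hs a ha
  exact ⟨k * a', mem_dilate.2 ⟨a', ha', rfl⟩, (mul_add _ _ _).symm⟩

theorem IsCentrallySymmetric.inflate {B : Finset ℕ} (h : IsCentrallySymmetric B) {k : ℕ}
    (hk : 0 < k) : IsCentrallySymmetric (inflate k B) := by
  obtain ⟨s, hs⟩ := h
  -- The reflection exchanges blocks and reverses each one, whence the extra `k - 1`.
  refine ⟨k * s + (k - 1), fun x hx => ?_⟩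
  obtain ⟨b, hb, e⟩ := hs _ ((mem_inflate hk).1 hx)
  have h1 := Nat.div_add_mod x k
  have h2 := Nat.mod_lt x hk
  refine ⟨k * b + (k - 1 - x % k), ?_, ?_⟩
  · rwa [mem_inflate hk, Nat.mul_add_div hk, Nat.div_eq_of_lt (by omega), add_zero]
  · rw [← e, mul_add]
    omega

/-- Induction along the descent, both scalings preserving symmetry. This makes the reversal
conditions automatic. -/
theorem IsTiling.isCentrallySymmetric {A B : Finset ℕ} {N : ℕ} (h : IsTiling A B N) (hN : 0 < N) :
    IsCentrallySymmetric A ∧ IsCentrallySymmetric B := by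
  induction N using Nat.strong_induction_on generalizing A B with
  | _ N ih =>
  have key : ∀ {A B : Finset ℕ}, IsTiling A B N → 1 ∈ B →
      IsCentrallySymmetric A ∧ IsCentrallySymmetric B := by
    intro A B h h1
    obtain ⟨k, A', B', N', hk, rfl, rfl, hNk, h', -⟩ := h.exists_dilate_inflate hN h1
    have hN' : 0 < N' := Nat.pos_of_ne_zero fun h0 => by simp [h0] at hNk; omega
    obtain ⟨hA, hB⟩ := ih N' (by nlinarith) h' hN'
    exact ⟨hA.dilate k, hB.inflate (by omega)⟩
  rcases Nat.eq_or_lt_of_le hN with h1 | h1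
  · have hz : ∀ {A B : Finset ℕ}, IsTiling A B N → IsCentrallySymmetric A := fun h =>
      ⟨0, fun a ha => ⟨a, ha, by have := h.lt ha (h.zero_mem_right hN); omega⟩⟩
    exact ⟨hz h, hz h.symm⟩
  · rcases h.one_mem_or h1 with h1 | h1
    · exact (key h.symm h1).symm
    · exact key h h1

/-! ### Counting tilings -/

open scoped Classical in
/-- The pairs of sets of cardinalities `a` and `b` which tile `[0, ab)`. -/
noncomputable def tilings (a b : ℕ) : Finset (Finset ℕ × Finset ℕ) :=
  ((Finset.range (a * b)).powerset ×ˢ (Finset.range (a * b)).powerset).filter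
    fun p => IsTiling p.1 p.2 (a * b) ∧ p.1.card = a ∧ p.2.card = b

section

variable {a b : ℕ}

theorem mem_tilings (ha : 0 < a) (hb : 0 < b) {p : Finset ℕ × Finset ℕ} :
    p ∈ tilings a b ↔ IsTiling p.1 p.2 (a * b) ∧ p.1.card = a ∧ p.2.card = b := by
  have hab := Nat.mul_pos ha hb
  simp only [tilings, Finset.mem_filter, Finset.mem_product, Finset.mem_powerset,
    and_iff_right_iff_imp]
  exact fun h => ⟨h.1.left_subset_range hab, h.1.symm.left_subset_range hab⟩

/-- The tilings whose second member contains `1`. -/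
noncomputable def tilingsOne (a b : ℕ) : Finset (Finset ℕ × Finset ℕ) :=
  (tilings a b).filter fun p => 1 ∈ p.2

theorem mem_tilingsOne (ha : 0 < a) (hb : 0 < b) {p : Finset ℕ × Finset ℕ} :
    p ∈ tilingsOne a b ↔ (IsTiling p.1 p.2 (a * b) ∧ p.1.card = a ∧ p.2.card = b) ∧ 1 ∈ p.2 := by
  rw [tilingsOne, Finset.mem_filter, mem_tilings ha hb]

/-- If `a * b > 1`, then `1` lies in exactly one of the two sets, so swapping them is a bijection;
the indicator counts `({0}, {0})`. -/
theorem card_tilings_one_notMem (ha : 0 < a) (hb : 0 < b) :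
    ((tilings a b).filter fun p => 1 ∉ p.2).card =
      (if a = 1 ∧ b = 1 then 1 else 0) + (tilingsOne b a).card := by
  have hab := Nat.mul_pos ha hb
  split_ifs with h
  · obtain ⟨rfl, rfl⟩ := h
    have h1 : tilingsOne 1 1 = ∅ := by
      refine Finset.eq_empty_of_forall_notMem fun p hp => ?_
      obtain ⟨⟨h, -⟩, h1⟩ := (mem_tilingsOne ha hb).1 hp
      have := h.lt (h.zero_mem_left hab) h1
      omega
    have h2 : ((tilings 1 1).filter fun p => 1 ∉ p.2) = {({0}, {0})} := by
      have hz : ∀ {A B : Finset ℕ}, IsTiling A B (1 * 1) → A = {0} := fun h => by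
        ext x
        rw [Finset.mem_singleton]
        constructor
        · intro hx
          have := h.lt hx (h.zero_mem_right hab)
          omega
        · rintro rfl
          exact h.zero_mem_left hab
      ext ⟨A, B⟩
      rw [Finset.mem_filter, mem_tilings ha hb, Finset.mem_singleton, Prod.mk.injEq]
      constructor
      · exact fun h => ⟨hz h.1.1, hz h.1.1.symm⟩
      · rintro ⟨rfl, rfl⟩
        refine ⟨⟨⟨by simp, by simp, by simp +contextual⟩, by simp, by simp⟩, by simp⟩
    rw [h1, h2]
    simp
  · rw [zero_add]
    have h1 : 1 < a * b := by
      by_contra hlt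
      exact h (mul_eq_one.1 (by omega))
    refine Finset.card_nbij' Prod.swap Prod.swap ?_ ?_ (fun _ _ => rfl) (fun _ _ => rfl)
    · rintro ⟨A, B⟩ hp
      rw [Finset.mem_coe, Finset.mem_filter, mem_tilings ha hb] at hp
      rw [Finset.mem_coe, mem_tilingsOne hb ha, mul_comm b a]
      exact ⟨⟨hp.1.1.symm, hp.1.2.2, hp.1.2.1⟩, (hp.1.1.one_mem_or h1).resolve_right hp.2⟩
    · rintro ⟨A, B⟩ hp
      rw [Finset.mem_coe, mem_tilingsOne hb ha, mul_comm b a] at hp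
      rw [Finset.mem_coe, Finset.mem_filter, mem_tilings ha hb]
      exact ⟨⟨hp.1.1.symm, hp.1.2.2, hp.1.2.1⟩, fun hA => hp.1.1.not_one_mem_both hab hA hp.2⟩

/-- The descent as a disjoint union over the length `k` of the initial run of the second set. -/
theorem card_tilingsOne (ha : 0 < a) (hb : 0 < b) :
    (tilingsOne a b).card =
      ∑ k ∈ b.divisors with 2 ≤ k, ((tilings a (b / k)).filter fun p => 1 ∉ p.2).card := by
  classical
  have hab := Nat.mul_pos ha hb
  have hdiv : ∀ {k}, k ∈ b.divisors.filter (2 ≤ ·) →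
      0 < k ∧ 2 ≤ k ∧ 0 < b / k ∧ k * (b / k) = b := fun {k} hk => by
    obtain ⟨h1, h2⟩ := Finset.mem_filter.1 hk
    have h3 := (Nat.mem_divisors.1 h1).1
    exact ⟨by omega, h2, Nat.div_pos (Nat.le_of_dvd hb h3) (by omega), Nat.mul_div_cancel' h3⟩
  have hU : tilingsOne a b = (b.divisors.filter (2 ≤ ·)).biUnion fun k =>
      ((tilings a (b / k)).filter fun p => 1 ∉ p.2).image (Prod.map (dilate k) (inflate k)) := by
    ext ⟨A, B⟩
    rw [mem_tilingsOne ha hb, Finset.mem_biUnion]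
    constructor
    · rintro ⟨⟨h, hA, hB⟩, h1⟩
      obtain ⟨k, A', B', N', hk, rfl, rfl, hNk, h', h1'⟩ := h.exists_dilate_inflate hab h1
      simp only [card_dilate (show 0 < k by omega), card_inflate] at hA hB
      have hbk : b / k = B'.card := by
        rw [← hB, Nat.mul_div_cancel_left _ (by omega)]
      refine ⟨k, Finset.mem_filter.2 ⟨Nat.mem_divisors.2 ⟨⟨_, hB.symm⟩, hb.ne'⟩, hk⟩,
        Finset.mem_image.2 ⟨(A', B'), Finset.mem_filter.2 ⟨?_, h1'⟩, rfl⟩⟩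
      rw [mem_tilings ha (Nat.div_pos (Nat.le_of_dvd hb ⟨_, hB.symm⟩) (by omega)), hbk]
      refine ⟨?_, hA, rfl⟩
      have hc := h'.card_mul_card
      rw [hA] at hc
      rwa [hc]
    · rintro ⟨k, hk, hp⟩
      obtain ⟨hk0, hk2, hbk, hkb⟩ := hdiv hk
      obtain ⟨⟨A', B'⟩, hp, e⟩ := Finset.mem_image.1 hp
      rw [Finset.mem_filter, mem_tilings ha hbk] at hp
      obtain ⟨⟨h, hA, hB⟩, h1⟩ := hp
      obtain ⟨rfl, rfl⟩ := Prod.mk.inj e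
      simp only at h hA hB h1 ⊢
      rw [card_dilate hk0, card_inflate, hA, hB, hkb, mem_inflate hk0, Nat.div_eq_of_lt (by omega)]
      refine ⟨⟨?_, rfl, rfl⟩, h.zero_mem_right (Nat.mul_pos ha hbk)⟩
      rw [← isTiling_dilate_inflate hk0] at h
      convert h using 1
      rw [mul_left_comm, hkb]
  rw [hU, Finset.card_biUnion]
  · refine Finset.sum_congr rfl fun k hk => Finset.card_image_of_injective _ ?_
    obtain ⟨hk0, -⟩ := hdiv hk
    exact (dilate_injective hk0).prodMap (inflate_injective hk0)
  -- For `k < l`, the number `k` lies in the initial run of `inflate l q.2` but not in `inflate k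
  -- p.2`, because `1 ∉ p.2`.
  · have key : ∀ {k l}, k ∈ b.divisors.filter (2 ≤ ·) → l ∈ b.divisors.filter (2 ≤ ·) → k < l →
        ∀ {p q : Finset ℕ × Finset ℕ}, 1 ∉ p.2 → q ∈ tilings a (b / l) →
          Prod.map (dilate k) (inflate k) p ≠ Prod.map (dilate l) (inflate l) q := by
      intro k l hk hl hkl p q hp hq e
      obtain ⟨hl0, -, hbl, -⟩ := hdiv hl
      have h0 := ((mem_tilings ha hbl).1 hq).1.zero_mem_right (Nat.mul_pos ha hbl)
      have h1 : k ∈ inflate l q.2 := by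
        rwa [mem_inflate hl0, Nat.div_eq_of_lt hkl]
      have h2 : inflate k p.2 = inflate l q.2 := congrArg Prod.snd e
      rw [← h2, mem_inflate (hdiv hk).1, Nat.div_self (hdiv hk).1] at h1
      exact hp h1
    intro k hk l hl hkl
    rw [Function.onFun, Finset.disjoint_left]
    rintro _ hp' hq'
    obtain ⟨p, hp, rfl⟩ := Finset.mem_image.1 hp'
    obtain ⟨q, hq, e⟩ := Finset.mem_image.1 hq'
    rw [Finset.mem_filter] at hp hq
    rcases lt_or_gt_of_ne hkl with h | h
    · exact key hk hl h hp.2 hq.1 e.symm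
    · exact key hl hk h hq.2 hp.1 e

/-- Strong induction on `a * b`, with `L` fixed so that the swapped pair has the same summation
range. -/
theorem card_tilingsOne_eq_sum {L : ℕ} (ha : 0 < a) (hb : 0 < b) (hL : a * b ≤ L) :
    (tilingsOne a b).card = ∑ j ∈ Finset.range L,
      nontrivDivisor (j + 1) b * (nontrivDivisor j a + nontrivDivisor (j + 1) a) := by
  induction hN : a * b using Nat.strong_induction_on generalizing a b with
  | _ N ih =>
  have hlast : nontrivDivisor L a = 0 := nontrivDivisor_eq_zero <| by
    have := cardFactors_lt_self ha.ne'
    nlinarith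
  rw [card_tilingsOne ha hb]
  simp only [nontrivDivisor_succ _ b, Finset.sum_mul]
  rw [Finset.sum_comm]
  refine Finset.sum_congr rfl fun k hk => ?_
  obtain ⟨h1, h2⟩ := Finset.mem_filter.1 hk
  have h3 := (Nat.mem_divisors.1 h1).1
  have hbk : 0 < b / k := Nat.div_pos (Nat.le_of_dvd hb h3) (by omega)
  have hlt : b / k * a < a * b := by
    rw [mul_comm]
    exact Nat.mul_lt_mul_of_pos_left (Nat.div_lt_self hb (by omega)) ha
  rw [card_tilings_one_notMem ha hbk, ih _ (hN ▸ hlt) hbk ha (by omega) rfl]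
  have h0 : (if a = 1 ∧ b / k = 1 then 1 else 0) =
      nontrivDivisor 0 (b / k) * nontrivDivisor 0 a := by
    rw [nontrivDivisor_zero_left, nontrivDivisor_zero_left]
    split_ifs <;> simp_all
  -- The indicator is the missing term `j = 0` of the diagonal sum; the extra top term vanishes by
  -- `hlast`.
  have hshift := Finset.sum_range_succ'
    (fun j => nontrivDivisor j (b / k) * nontrivDivisor j a) L
  rw [Finset.sum_range_succ, hlast, mul_zero, add_zero] at hshift
  simp only [mul_add, Finset.sum_add_distrib, h0, hshift]
  simp only [mul_comm (nontrivDivisor _ a)]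
  ring

theorem card_tilingsOne_self {n : ℕ} (hn : 0 < n) :
    (tilingsOne n n).card = ∑ j ∈ Finset.Icc 1 (ArithmeticFunction.cardFactors n),
      nontrivDivisor j n * (nontrivDivisor j n + nontrivDivisor (j + 1) n) := by
  have hlt := cardFactors_lt_self hn.ne'
  have hsq : n ≤ n * n := Nat.le_mul_of_pos_left n hn
  rw [card_tilingsOne_eq_sum hn hn le_rfl]
  have hsub : ∑ j ∈ Finset.Icc 1 (ArithmeticFunction.cardFactors n),
      nontrivDivisor j n * (nontrivDivisor j n + nontrivDivisor (j + 1) n) =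
      ∑ j ∈ Finset.range (n * n), nontrivDivisor (j + 1) n *
        (nontrivDivisor (j + 1) n + nontrivDivisor (j + 2) n) := by
    rw [Finset.range_eq_Ico, Finset.sum_Ico_add'
      (fun j => nontrivDivisor j n * (nontrivDivisor j n + nontrivDivisor (j + 1) n))]
    refine Finset.sum_subset (fun j hj => ?_) fun j hj hj' => ?_
    · rw [Finset.mem_Icc] at hj
      rw [Finset.mem_Ico]
      omega
    · rw [Finset.mem_Icc] at hj'
      rw [Finset.mem_Ico] at hj
      rw [nontrivDivisor_eq_zero (by omega), zero_mul]
  have hshift := Finset.sum_range_succ' (fun j => nontrivDivisor (j + 1) n * nontrivDivisor j n)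
    (n * n)
  -- The boundary term of the shift `c_{j+1} c_j ↦ c_{j+2} c_{j+1}`: `c_0` lives only at `1`, where
  -- `c_1` vanishes.
  have h01 : nontrivDivisor 1 n * nontrivDivisor 0 n = 0 := by
    rw [nontrivDivisor_zero_left]
    split_ifs with h
    · rw [nontrivDivisor_eq_zero (by simp [h]), zero_mul]
    · rw [mul_zero]
  rw [Finset.sum_range_succ, nontrivDivisor_eq_zero (j := n * n) (by omega)] at hshift
  simp only [zero_add, h01, mul_zero, add_zero] at hshift
  rw [hsub]
  simp only [mul_add, Finset.sum_add_distrib, hshift]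
  rw [add_comm]
  simp only [mul_comm (nontrivDivisor (_ + 2) n)]

end

/-! ### Increasing enumeration of finite sets -/

/-- The `t`-th element of `A` in increasing order. -/
def enum (A : Finset ℕ) (t : ℕ) : ℕ := (A.sort (· ≤ ·)).getD t 0

section

variable {A : Finset ℕ} {s t : ℕ}

theorem enum_eq_orderEmbOfFin (ht : t < A.card) : enum A t = A.orderEmbOfFin rfl ⟨t, ht⟩ := by
  rw [enum, Finset.orderEmbOfFin_apply, List.getD_eq_getElem, Fin.getElem_fin]

theorem enum_lt_enum (hst : s < t) (ht : t < A.card) : enum A s < enum A t := by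
  rw [enum_eq_orderEmbOfFin ht, enum_eq_orderEmbOfFin (hst.trans ht)]
  exact (A.orderEmbOfFin rfl).strictMono hst

theorem enum_mem (ht : t < A.card) : enum A t ∈ A := by
  rw [enum_eq_orderEmbOfFin ht]
  exact A.orderEmbOfFin_mem rfl _

theorem exists_enum_eq {x : ℕ} (hx : x ∈ A) : ∃ t < A.card, enum A t = x := by
  have := A.range_orderEmbOfFin rfl
  rw [← Finset.mem_coe, ← this] at hx
  obtain ⟨⟨t, ht⟩, e⟩ := hx
  exact ⟨t, ht, by rw [enum_eq_orderEmbOfFin ht, e]⟩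

theorem eq_enum {f : ℕ → ℕ} (hf : ∀ t < A.card, f t ∈ A)
    (hmono : ∀ s t, s < t → t < A.card → f s < f t) (ht : t < A.card) : f t = enum A t := by
  rw [enum_eq_orderEmbOfFin ht, ← A.orderEmbOfFin_unique rfl (f := fun i => f i)
    (fun i => hf i i.2) (fun i j hij => hmono i j hij j.2)]

theorem enum_zero (h : 0 ∈ A) : enum A 0 = 0 := by
  obtain ⟨t, ht, e⟩ := exists_enum_eq h
  rcases Nat.eq_zero_or_pos t with rfl | h0
  · exact e
  · have := enum_lt_enum h0 ht
    omega

theorem enum_one (h0 : 0 ∈ A) (h1 : 1 ∈ A) : enum A 1 = 1 := by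
  obtain ⟨t, ht, e⟩ := exists_enum_eq h1
  have hz := enum_zero h0
  have ht0 : t ≠ 0 := fun h => by rw [h, hz] at e; omega
  have h2 := enum_lt_enum zero_lt_one (A := A) (by omega)
  rcases Nat.eq_or_lt_of_le (Nat.one_le_iff_ne_zero.2 ht0) with rfl | h
  · exact e
  · have := enum_lt_enum h ht
    omega

/-- The reflection reverses order, so `s - enum A (A.card - 1 - t)` is again the increasing
enumeration. -/
theorem IsCentrallySymmetric.enum_add_enum (h : IsCentrallySymmetric A) :
    ∃ s, ∀ t < A.card, enum A t + enum A (A.card - 1 - t) = s := by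
  obtain ⟨s, hs⟩ := h
  have hle : ∀ t < A.card, enum A t ≤ s := fun t ht => by
    obtain ⟨a, -, e⟩ := hs _ (enum_mem ht)
    omega
  refine ⟨s, fun t ht => ?_⟩
  have := eq_enum (A := A) (f := fun t => s - enum A (A.card - 1 - t)) (t := t)
    (fun t ht => ?_) (fun i j hij hj => ?_) ht
  · have := hle (A.card - 1 - t) (by omega)
    omega
  · obtain ⟨a, ha, e⟩ := hs _ (enum_mem (A := A) (t := A.card - 1 - t) (by omega))
    rwa [← e, Nat.add_sub_cancel_left]
  · have h1 := enum_lt_enum (A := A) (s := A.card - 1 - j) (t := A.card - 1 - i) (by omega)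
      (by omega)
    have := hle (A.card - 1 - i) (by omega)
    omega

theorem ext_enum {B : Finset ℕ} (hc : A.card = B.card) (h : ∀ t < A.card, enum A t = enum B t) :
    A = B := by
  ext x
  constructor
  · intro hx
    obtain ⟨t, ht, rfl⟩ := exists_enum_eq hx
    rw [h t ht]
    exact enum_mem (hc ▸ ht)
  · intro hx
    obtain ⟨t, ht, rfl⟩ := exists_enum_eq hx
    rw [← h t (hc ▸ ht)]
    exact enum_mem (hc ▸ ht)

end

/-! ### Squares correspond to tilings -/

section

variable {n : ℕ} [NeZero n]

theorem val_natCast_sub_one {n a : ℕ} (h1 : 1 ≤ a) (h2 : a ≤ n) : ((a : ZMod n) - 1).val = a - 1 := by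
  rw [← Nat.cast_one, ← Nat.cast_sub h1, ZMod.val_cast_of_lt (by omega)]

theorem natCast_val_sub_one_add_one (i : ZMod n) : (((i - 1).val + 1 : ℕ) : ZMod n) = i := by
  rw [Nat.cast_add, ZMod.natCast_zmod_val, Nat.cast_one, sub_add_cancel]

theorem val_reverse_sub_one (i : ZMod n) :
    ((n : ZMod n) + 1 - i - 1).val = n - 1 - (i - 1).val := by
  have h := ZMod.val_lt (i - 1)
  have e : (n : ZMod n) + 1 - i - 1 = ((n - 1 - (i - 1).val : ℕ) : ZMod n) := by
    rw [Nat.cast_sub (by omega), Nat.cast_sub (by omega), ZMod.natCast_zmod_val, Nat.cast_one]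
    ring
  rw [e, ZMod.val_cast_of_lt (by omega)]

/-- The square with entries `1 + a + b`, where `a` and `b` run through `A` and `B` in increasing
order. -/
def sumSquare (n : ℕ) (p : Finset ℕ × Finset ℕ) : Matrix (ZMod n) (ZMod n) ℝ := fun i j =>
  ((1 + enum p.1 (i - 1).val + enum p.2 (j - 1).val : ℕ) : ℝ)

theorem isPrincipalReversibleSquare_sumSquare {p : Finset ℕ × Finset ℕ} (hp : p ∈ tilingsOne n n) :
    IsPrincipalReversibleSquare n (sumSquare n p) := by
  have hn := NeZero.pos n
  have hN := Nat.mul_pos hn hn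
  obtain ⟨A, B⟩ := p
  obtain ⟨⟨h, hA, hB⟩, h1⟩ := (mem_tilingsOne hn hn).1 hp
  simp only at h hA hB h1
  have hval : ∀ i : ZMod n, (i - 1).val < n := fun i => ZMod.val_lt _
  obtain ⟨hsA, hsB⟩ := h.isCentrallySymmetric hN
  have hA0 := enum_zero (h.zero_mem_left hN)
  have hB0 := enum_zero (h.zero_mem_right hN)
  have hB1 := enum_one (h.zero_mem_right hN) h1
  -- Ensures that the column index `2` is in range for the condition on the first entries.
  have hn2 : 2 ≤ n := by
    rw [← hB]
    exact Finset.one_lt_card.2 ⟨0, h.zero_mem_right hN, 1, h1, zero_ne_one⟩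
  refine ⟨⟨fun i j k => ?_, fun i j k => ?_, fun i j k l => ?_⟩, ?_, fun i a b h1 h2 h3 => ?_,
    fun j a b h1 h2 h3 => ?_, ?_⟩
  · obtain ⟨s, hs⟩ := hsB.enum_add_enum
    rw [hB] at hs
    have e1 := hs _ (hval j)
    have e2 := hs _ (hval k)
    simp only [sumSquare, val_reverse_sub_one]
    norm_cast
    omega
  · obtain ⟨s, hs⟩ := hsA.enum_add_enum
    rw [hA] at hs
    have e1 := hs _ (hval i)
    have e2 := hs _ (hval k)
    simp only [sumSquare, val_reverse_sub_one]
    norm_cast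
    omega
  · simp only [sumSquare]
    norm_cast
    omega
  · ext x
    simp only [Set.mem_ofPred_eq, sumSquare]
    constructor
    · rintro ⟨i, j, rfl⟩
      refine ⟨_, by omega, ?_, rfl⟩
      have := h.lt (enum_mem (A := A) (t := (i - 1).val) (by rw [hA]; exact hval i))
        (enum_mem (A := B) (t := (j - 1).val) (by rw [hB]; exact hval j))
      rw [sq]
      omega
    · rintro ⟨m, hm1, hm2, rfl⟩
      obtain ⟨a, ha, b, hb, e⟩ := h.exists_add (m - 1) (by rw [sq] at hm2; omega)
      obtain ⟨s, hs, rfl⟩ := exists_enum_eq ha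
      obtain ⟨t, ht, rfl⟩ := exists_enum_eq hb
      refine ⟨((s + 1 : ℕ) : ZMod n), ((t + 1 : ℕ) : ZMod n), ?_⟩
      rw [val_natCast_sub_one (by omega) (by omega), val_natCast_sub_one (by omega) (by omega)]
      simp only [Nat.add_sub_cancel]
      norm_cast
      omega
  · have := enum_lt_enum (A := B) (s := a - 1) (t := b - 1) (by omega) (by omega)
    simp only [sumSquare]
    rw [val_natCast_sub_one h1 (by omega), val_natCast_sub_one (by omega) h3]
    norm_cast
    omega
  · have := enum_lt_enum (A := A) (s := a - 1) (t := b - 1) (by omega) (by omega)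
    simp only [sumSquare]
    rw [val_natCast_sub_one h1 (by omega), val_natCast_sub_one (by omega) h3]
    norm_cast
    omega
  · intro j hj
    simp only [sumSquare]
    rw [sub_self, ZMod.val_zero, val_natCast_sub_one (by omega) (by omega), hA0]
    norm_cast
    rcases hj with rfl | rfl
    · rw [Nat.sub_self, hB0]
    · rw [show 2 - 1 = 1 from rfl, hB1]

/-- Both enumerations start at `0`, so the first column and first row recover the two sets. -/
theorem sumSquare_injOn : Set.InjOn (sumSquare n) (tilingsOne n n : Set (Finset ℕ × Finset ℕ)) := by
  have hn := NeZero.pos n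
  have hN := Nat.mul_pos hn hn
  rintro ⟨A, B⟩ hp ⟨A', B'⟩ hp' e
  obtain ⟨⟨h, hA, hB⟩, -⟩ := (mem_tilingsOne hn hn).1 (Finset.mem_coe.1 hp)
  obtain ⟨⟨h', hA', hB'⟩, -⟩ := (mem_tilingsOne hn hn).1 (Finset.mem_coe.1 hp')
  simp only at h hA hB h' hA' hB'
  have hent : ∀ s t, s < n → t < n → enum A s + enum B t = enum A' s + enum B' t := by
    intro s t hs ht
    have := congrFun (congrFun e ((s + 1 : ℕ) : ZMod n)) ((t + 1 : ℕ) : ZMod n)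
    simp only [sumSquare] at this
    rw [val_natCast_sub_one (by omega) (by omega), val_natCast_sub_one (by omega) (by omega)]
      at this
    simp only [Nat.add_sub_cancel] at this
    norm_cast at this
    omega
  have hA0 := enum_zero (h.zero_mem_left hN)
  have hB0 := enum_zero (h.zero_mem_right hN)
  have hA0' := enum_zero (h'.zero_mem_left hN)
  have hB0' := enum_zero (h'.zero_mem_right hN)
  refine Prod.ext (ext_enum (hA.trans hA'.symm) fun t ht => ?_)
    (ext_enum (hB.trans hB'.symm) fun t ht => ?_)
  · have := hent t 0 (by simp only at ht; omega) hn
    simp only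
    omega
  · have := hent 0 t hn (by simp only at ht; omega)
    simp only
    omega

theorem IsPrincipalReversibleSquare.exists_sumSquare_eq {M : Matrix (ZMod n) (ZMod n) ℝ}
    (hM : IsPrincipalReversibleSquare n M) : ∃ p ∈ tilingsOne n n, sumSquare n p = M := by
  have hn := NeZero.pos n
  have hentry : ∀ i j, ∃ m : ℕ, 1 ≤ m ∧ m ≤ n ^ 2 ∧ M i j = m := fun i j => by
    have : M i j ∈ {x : ℝ | ∃ i j : ZMod n, M i j = x} := ⟨i, j, rfl⟩
    rwa [hM.entries] at this
  choose g hg1 hg2 hg using hentry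
  have h11 : g 1 1 = 1 := by
    have := hM.first_entries 1 (Or.inl rfl)
    rw [Nat.cast_one, hg] at this
    exact_mod_cast this
  have h12 : g 1 ((2 : ℕ) : ZMod n) = 2 := by
    have := hM.first_entries 2 (Or.inr rfl)
    rw [hg] at this
    exact_mod_cast this
  -- The vertex condition against the corner splits each entry into its first-column and first-row
  -- parts.
  have hvert : ∀ i j, g i j + 1 = g i 1 + g 1 j := fun i j => by
    have := hM.vertex i j 1 1
    simp only [hg, h11] at this
    exact_mod_cast this
  set f : ℕ → ℕ := fun t => g ((t + 1 : ℕ) : ZMod n) 1 - 1 with hf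
  set h : ℕ → ℕ := fun t => g 1 ((t + 1 : ℕ) : ZMod n) - 1 with hh
  have hfi : ∀ i : ZMod n, f (i - 1).val = g i 1 - 1 := fun i => by
    simp only [hf, natCast_val_sub_one_add_one]
  have hhj : ∀ j : ZMod n, h (j - 1).val = g 1 j - 1 := fun j => by
    simp only [hh, natCast_val_sub_one_add_one]
  have hfmono : ∀ s t, s < t → t < n → f s < f t := fun s t hst ht => by
    have := hM.col_increasing 1 (s + 1) (t + 1) (by omega) (by omega) (by omega)
    rw [hg, hg, Nat.cast_lt] at this
    have := hg1 ((s + 1 : ℕ) : ZMod n) 1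
    simp only [hf]
    omega
  have hhmono : ∀ s t, s < t → t < n → h s < h t := fun s t hst ht => by
    have := hM.row_increasing 1 (s + 1) (t + 1) (by omega) (by omega) (by omega)
    rw [hg, hg, Nat.cast_lt] at this
    have := hg1 1 ((s + 1 : ℕ) : ZMod n)
    simp only [hh]
    omega
  have hcard : ∀ {u : ℕ → ℕ}, (∀ s t, s < t → t < n → u s < u t) →
      ((Finset.range n).image u).card = n := by
    intro u hu
    rw [Finset.card_image_of_injOn, Finset.card_range]
    intro s hs t ht e
    rw [Finset.mem_coe, Finset.mem_range] at hs ht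
    rcases lt_trichotomy s t with hst | hst | hst
    · exact absurd e (hu s t hst ht).ne
    · exact hst
    · exact absurd e (hu t s hst hs).ne'
  have henum : ∀ {u : ℕ → ℕ}, (∀ s t, s < t → t < n → u s < u t) → ∀ t < n,
      u t = enum ((Finset.range n).image u) t := by
    intro u hu t ht
    refine eq_enum (fun t ht => ?_) (fun s t hst ht => hu s t hst ?_) ?_
    · rw [hcard hu] at ht
      exact Finset.mem_image_of_mem _ (Finset.mem_range.2 ht)
    · rwa [hcard hu] at ht
    · rwa [hcard hu]
  refine ⟨((Finset.range n).image f, (Finset.range n).image h), ?_, ?_⟩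
  · rw [mem_tilingsOne hn hn]
    refine ⟨⟨IsTiling.of_card ?_ ?_ ?_, hcard hfmono, hcard hhmono⟩, ?_⟩
    · intro a b ha hb
      obtain ⟨s, -, rfl⟩ := Finset.mem_image.1 ha
      obtain ⟨t, -, rfl⟩ := Finset.mem_image.1 hb
      have h1 := hvert ((s + 1 : ℕ) : ZMod n) ((t + 1 : ℕ) : ZMod n)
      have h2 := hg2 ((s + 1 : ℕ) : ZMod n) ((t + 1 : ℕ) : ZMod n)
      have h3 := hg1 ((s + 1 : ℕ) : ZMod n) 1
      have h4 := hg1 1 ((t + 1 : ℕ) : ZMod n)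
      rw [sq] at h2
      simp only [hf, hh]
      omega
    · intro x hx
      have : ((x + 1 : ℕ) : ℝ) ∈ {x : ℝ | ∃ i j : ZMod n, M i j = x} := by
        rw [hM.entries]
        exact ⟨x + 1, by omega, by rw [sq]; omega, rfl⟩
      obtain ⟨i, j, e⟩ := this
      rw [hg, Nat.cast_inj] at e
      refine ⟨f (i - 1).val, Finset.mem_image_of_mem _ (Finset.mem_range.2 (ZMod.val_lt _)),
        h (j - 1).val, Finset.mem_image_of_mem _ (Finset.mem_range.2 (ZMod.val_lt _)), ?_⟩
      rw [hfi, hhj]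
      have h1 := hvert i j
      have h3 := hg1 i 1
      have h4 := hg1 1 j
      omega
    · rw [hcard hfmono, hcard hhmono]
    -- This form of the index, unlike the literal `1`, is below `n` even for `n = 1`, so no case
    -- split is needed.
    · refine Finset.mem_image.2 ⟨(((2 : ℕ) : ZMod n) - 1).val,
        Finset.mem_range.2 (ZMod.val_lt _), ?_⟩
      rw [hhj, h12]
  · ext i j
    simp only [sumSquare]
    rw [← henum hfmono _ (ZMod.val_lt _), ← henum hhmono _ (ZMod.val_lt _), hfi, hhj, hg,
      Nat.cast_inj]
    have h1 := hvert i j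
    have h3 := hg1 i 1
    have h4 := hg1 1 j
    omega

theorem numPrincipalReversibleSquares_eq_card :
    numPrincipalReversibleSquares n = ((tilingsOne n n).card : ℕ∞) := by
  have : {M : Matrix (ZMod n) (ZMod n) ℝ | IsPrincipalReversibleSquare n M} =
      sumSquare n '' (tilingsOne n n : Set (Finset ℕ × Finset ℕ)) := by
    ext M
    constructor
    · intro hM
      obtain ⟨p, hp, e⟩ := hM.exists_sumSquare_eq
      exact ⟨p, hp, e⟩
    · rintro ⟨p, hp, rfl⟩
      exact isPrincipalReversibleSquare_sumSquare hp
  rw [numPrincipalReversibleSquares, this, sumSquare_injOn.encard_image,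
    Set.encard_coe_eq_coe_finsetCard]

end

theorem theorem6p2 (n : ℕ) (hn : 1 ≤ n) :
    numPrincipalReversibleSquares n =
        ((∑ j ∈ Finset.Icc 1 (ArithmeticFunction.cardFactors n),
          nontrivDivisor j n * (nontrivDivisor j n + nontrivDivisor (j + 1) n) : ℕ) : ℕ∞) ∧
      (∑ j ∈ Finset.Icc 1 (ArithmeticFunction.cardFactors n),
          nontrivDivisor j n * (nontrivDivisor j n + nontrivDivisor (j + 1) n)) =
        ∑ j ∈ Finset.Icc 1 (ArithmeticFunction.cardFactors n),
          assocDivisor 0 j n * assocDivisor 1 j n := by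

  have : NeZero n := ⟨by omega⟩
  refine ⟨?_, Finset.sum_congr rfl fun j _ => ?_⟩
  · rw [numPrincipalReversibleSquares_eq_card, card_tilingsOne_self hn]
  · simp only [assocDivisor]
    rw [sum_divisors_nontrivDivisor j (by omega)]
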